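/- \textbf{Setting.} A point cloud of size $n\ge 1$ is a tuple $P=(p_1,\dots,p_n)$ of (not necessarily distinct) points of $\mathbb{R}^3$; $d_{uv}=\|p_u-p_v\|$. Clouds $P,Q$ are isomorphic if they have the same size $n$ and there are a permutation $\sigma$ of $[n]$, $R\in O(3)$ and $t\in\mathbb{R}^3$ with $q_{\sigma(i)}=Rp_i+t$ for all $i$. A map $f$ on point clouds of all sizes is E(3)-complete if isomorphic clouds have the same value and non-isomorphic clouds have different values; it is E(3)-complete up to size $N$ if this holds for clouds with at most $N$ points ($N=\infty$: all clouds). \textbf{Models.} Let $r_{\mathrm{sub}},r_{\mathrm{cutoff}}\in[0,\infty]$. The distance graph $G$ of $P$ has vertex set $[n]$ and edges $(u,v)$ with $d_{uv}\le r_{\mathrm{cutoff}}$; $G^u$ is its subgraph induced on $\{i: d_{iu}\le r_{\mathrm{sub}}\}$ and $\mathcal N_{G^u}(v)$ is the set of neighbours of $v$ in $G^u$ (a vertex of $G^u$ is its own neighbour, and $\mathcal N_{G^u}(v)=\emptyset$ if $v$ is not a vertex of $G^u$). A general geometric subgraph GNN $\mathsf{GeoA}(\mathcal B,\mathsf{Pool},L,r_{\mathrm{sub}},r_{\mathrm{cutoff}})$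 with $L$ layers, where $\mathcal B$ is any set of the operations listed below and $\mathsf{Pool}\in\{\mathsf{VS},\mathsf{SV}\}$, computes real feature vectors (of arbitrary finite dimensions) $h^{(0)}_{uv}=f^{\mathrm{init}}(\mathbf 1_{u=v})$ and $h^{(l+1)}_{uv}=f^{(l+1)}\big(h^{(l)}_{uv},(\mathsf{op}(u,v,h^{(l)},G))_{\mathsf{op}\in\mathcal B}\big)$ for $0\le l<L$, where the available operations are the single-point ones $h_{uu}$, $h_{vv}$, $h_{vu}$, the global ones $\{\!\{h_{uw}: w\in[n]\}\!\}$, $\{\!\{h_{wv}: w\in[n]\}\!\}$ and the local ones $\{\!\{(h_{uw},d_{vw}): w\in\mathcal N_{G^u}(v)\}\!\}$, $\{\!\{(h_{wv},d_{uw}): w\in\mathcal N_{G^v}(u)\}\!\}$. Its output is $f^{\mathsf G}\big(\{\!\{ f^{\mathsf S}(\{\!\{h^{(L)}_{uv}: v\in[n]\}\!\}) : u\in[n]\}\!\}\big)$ for $\mathsf{VS}$ pooling and $f^{\mathsf G}\big(\{\!\{ f^{\mathsf V}(\{\!\{h^{(L)}_{uv}: u\in[n]\}\!\}) : v\in[n]\}\!\}\big)$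 for $\mathsf{SV}$ pooling, with values in some $\mathbb{R}^k$. For $N\in\mathbb{N}\cup\{\infty\}$, an instance of the model is called injective up to size $N$ if $f^{\mathrm{init}}$ is injective and all layer and pooling functions are injective on the inputs whose multisets have at most $N$ elements (for $N=\infty$: on all inputs). \textbf{Theorem (completeness of general geometric subgraph GNNs).} There is an absolute constant $C$ such that for every set $\mathcal B$ of operations that contains at least one of the two local operations, every pooling scheme $\mathsf{Pool}\in\{\mathsf{VS},\mathsf{SV}\}$ and every $L>C$ the following holds with $r_{\mathrm{sub}}=r_{\mathrm{cutoff}}=\infty$. \begin{enumerate} \item For every $N\in\mathbb{N}\cup\{\infty\}$, every instance of $\mathsf{GeoA}(\mathcal B,\mathsf{Pool},L,\infty,\infty)$ that is injective up to size $N$ is E(3)-complete up to size $N$. In particular, every instance all of whose functions are injective is E(3)-complete. \item Such instances exist: there is one that is injective up to size $\infty$, and for every finite $N$ there is one whose layer and pooling functions are moreover continuous (for the quotient topology on finite multisets) and which is injective up to size $N$. \end{enumerate} -/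

import Mathlib

/-- Three-dimensional Euclidean space. -/
abbrev E3 : Type := EuclideanSpace ℝ (Fin 3)

/-- An (unlabeled) point cloud with `n` points; points may coincide. -/
abbrev PointCloud (n : ℕ) : Type := Fin n → E3

/-- Two point clouds are isomorphic if they agree up to a relabeling of the points, an orthogonal
map and a translation (a bijection `Fin n ≃ Fin m` forces `n = m`). -/
def PointCloud.Isomorphic {n m : ℕ} (P : PointCloud n) (Q : PointCloud m) : Prop :=
  ∃ (σ : Fin n ≃ Fin m) (R : E3 ≃ₗᵢ[ℝ] E3) (t : E3), ∀ i, Q (σ i) = R (P i) + t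

/-- A map `f` on point clouds of all sizes is E(3)-complete on the clouds with at least one and at
most `N` points: it is invariant under isomorphism and takes different values at any two
non-isomorphic clouds. For `N = ⊤` this is E(3)-completeness on all nonempty finite clouds. -/
def IsE3CompleteUpTo {Y : Type} (N : ℕ∞) (f : ∀ n : ℕ, PointCloud n → Y) : Prop :=
  ∀ n m : ℕ, 1 ≤ n → (n : ℕ∞) ≤ N → 1 ≤ m → (m : ℕ∞) ≤ N →
    ∀ (P : PointCloud n) (Q : PointCloud m),
      (P.Isomorphic Q → f n P = f m Q) ∧ (¬ P.Isomorphic Q → f n P ≠ f m Q)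

section Graph

open Classical in
/-- Vertex set of the ego subgraph of node `u`: the nodes within distance `rsub` of `u`. -/
noncomputable def subVertices (rsub : ENNReal) {n : ℕ} (P : PointCloud n) (u : Fin n) :
    Finset (Fin n) :=
  Finset.univ.filter fun i => edist (P i) (P u) ≤ rsub

/-- Edges of the distance graph with interaction cutoff `rcut`. -/
def IsDistEdge (rcut : ENNReal) {n : ℕ} (P : PointCloud n) (i j : Fin n) : Prop :=
  edist (P i) (P j) ≤ rcut

open Classical in
/-- Neighbors of `v` in the ego subgraph of `u`: those `i` for which `(i, v)` is an edge of the
distance graph with both endpoints in the ego subgraph of `u`. -/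
noncomputable def subNeighbors (rsub rcut : ENNReal) {n : ℕ} (P : PointCloud n) (u v : Fin n) :
    Finset (Fin n) :=
  Finset.univ.filter fun i =>
    i ∈ subVertices rsub P u ∧ v ∈ subVertices rsub P u ∧ IsDistEdge rcut P i v

end Graph

/-- The optional atomic operations of a layer. -/
inductive Agg : Type
  | pointUU
  | pointVV
  | pointVU
  | globalU
  | globalV
  | localU
  | localV

/-- The type of the values of an atomic operation when the pair features live in `X`. -/
def Agg.Val (X : Type) : Agg → Type
  | .pointUU => X
  | .pointVV => X
  | .pointVU => X
  | .globalU => Multiset X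
  | .globalV => Multiset X
  | .localU => Multiset (X × ℝ)
  | .localV => Multiset (X × ℝ)

/-- The value of an atomic operation at the pair `(u, v)`, where `h u v` is the current feature
of node `v` in the subgraph of node `u`. -/
noncomputable def Agg.apply {X : Type} (rsub rcut : ENNReal) {n : ℕ} (P : PointCloud n)
    (h : Fin n → Fin n → X) (u v : Fin n) : (a : Agg) → Agg.Val X a
  | .pointUU => h u u
  | .pointVV => h v v
  | .pointVU => h v u
  | .globalU => (Finset.univ : Finset (Fin n)).val.map fun w => h u w
  | .globalV => (Finset.univ : Finset (Fin n)).val.map fun w => h w v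
  | .localU => (subNeighbors rsub rcut P u v).val.map fun w => (h u w, dist (P v) (P w))
  | .localV => (subNeighbors rsub rcut P v u).val.map fun w => (h w v, dist (P u) (P w))

/-- The number of elements of the multiset that an operation returns, and `0` for a single-point
operation. -/
def Agg.size {X : Type} : (a : Agg) → Agg.Val X a → ℕ
  | .pointUU, _ => 0
  | .pointVV, _ => 0
  | .pointVU, _ => 0
  | .globalU, s => Multiset.card (show Multiset X from s)
  | .globalV, s => Multiset.card (show Multiset X from s)
  | .localU, s => Multiset.card (show Multiset (X × ℝ) from s)
  | .localV, s => Multiset.card (show Multiset (X × ℝ) from s)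

/-- The natural topology on finite multisets: the quotient of the topology on lists, that is,
the disjoint union over `k` of the quotients of `X ^ k` by permutations. -/
instance multisetTopology (X : Type) [TopologicalSpace X] : TopologicalSpace (Multiset X) :=
  TopologicalSpace.coinduced (fun l : List X => (l : Multiset X)) inferInstance

instance Agg.valTopology (X : Type) [TopologicalSpace X] :
    (a : Agg) → TopologicalSpace (Agg.Val X a)
  | .pointUU => inferInstanceAs (TopologicalSpace X)
  | .pointVV => inferInstanceAs (TopologicalSpace X)
  | .pointVU => inferInstanceAs (TopologicalSpace X)
  | .globalU => inferInstanceAs (TopologicalSpace (Multiset X))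
  | .globalV => inferInstanceAs (TopologicalSpace (Multiset X))
  | .localU => inferInstanceAs (TopologicalSpace (Multiset (X × ℝ)))
  | .localV => inferInstanceAs (TopologicalSpace (Multiset (X × ℝ)))

/-- Real feature vectors. -/
abbrev Vec (d : ℕ) : Type := Fin d → ℝ

/-- The input of a layer function: the current feature of the pair together with the values of
the operations in `B`. -/
abbrev LayerInput (B : Set Agg) (X : Type) : Type := X × ((a : B) → Agg.Val X a.1)

/-- The two pooling schemes: vertex-subgraph and subgraph-vertex. -/
inductive Pooling : Type
  | VS
  | SV

/-- An instance of the general geometric subgraph GNN with `L` layers, each of aggregation scheme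
`B` (in addition to the feature of the pair itself): a choice of all its functions. Only the
layers `l < L` are ever used. -/
structure GeoA (B : Set Agg) (L : ℕ) : Type where
  featDim : ℕ → ℕ
  poolDim : ℕ
  outDim : ℕ
  /-- initial feature, a function of the node marking -/
  fInit : Bool → Vec (featDim 0)
  fLayer : (l : ℕ) → LayerInput B (Vec (featDim l)) → Vec (featDim (l + 1))
  /-- first-level pooling -/
  fInner : Multiset (Vec (featDim L)) → Vec poolDim
  /-- second-level pooling -/
  fOuter : Multiset (Vec poolDim) → Vec outDim

namespace GeoA

variable {B : Set Agg} {L : ℕ}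

/-- `M.feature rsub rcut P l u v` is the feature of node `v` in the subgraph of `u` after `l`
layers. -/
noncomputable def feature (M : GeoA B L) (rsub rcut : ENNReal) {n : ℕ} (P : PointCloud n) :
    (l : ℕ) → Fin n → Fin n → Vec (M.featDim l)
  | 0 => fun u v => M.fInit (decide (u = v))
  | l + 1 => fun u v =>
      M.fLayer l (M.feature rsub rcut P l u v,
        fun a => a.1.apply rsub rcut P (M.feature rsub rcut P l) u v)

/-- The graph-level output. -/
noncomputable def output (M : GeoA B L) (rsub rcut : ENNReal) :
    (pool : Pooling) → (n : ℕ) → PointCloud n → Vec M.outDim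
  | .VS => fun n P => M.fOuter ((Finset.univ : Finset (Fin n)).val.map fun u =>
      M.fInner ((Finset.univ : Finset (Fin n)).val.map fun v => M.feature rsub rcut P L u v))
  | .SV => fun n P => M.fOuter ((Finset.univ : Finset (Fin n)).val.map fun v =>
      M.fInner ((Finset.univ : Finset (Fin n)).val.map fun u => M.feature rsub rcut P L u v))

/-- All functions of the model are injective on the inputs whose multisets have at most `N`
elements. For `N = ⊤` they are injective everywhere. -/
def IsInjectiveUpTo (M : GeoA B L) (N : ℕ∞) : Prop :=
  Function.Injective M.fInit ∧
  (∀ l < L, Set.InjOn (M.fLayer l) {x | ∀ a : B, (a.1.size (x.2 a) : ℕ∞) ≤ N}) ∧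
  Set.InjOn M.fInner {s | (Multiset.card s : ℕ∞) ≤ N} ∧
  Set.InjOn M.fOuter {s | (Multiset.card s : ℕ∞) ≤ N}

/-- All layer and pooling functions of the model are continuous. -/
def IsContinuous (M : GeoA B L) : Prop :=
  (∀ l < L, Continuous (M.fLayer l)) ∧ Continuous M.fInner ∧ Continuous M.fOuter

end GeoA

open scoped RealInnerProductSpace

/-! Completeness reduces to colour refinement with one marked point. With infinite radii a local
operation sees every point, so injectivity turns equal outputs into matchings of coloured points
that preserve distances (`RefineMatch`). Two rounds recover each point's distance to the marked
point and to the barycenter. Put the barycenter at the origin and mark a point `e` away from it: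
colours now fix length and height along the axis of `e` (`RefineMatch.axisMatch`).

Two further rounds fix the rotation about that axis (`exists_isometry_of_axisMatch`). Among pairs
not parallel modulo the axis, take `x`, `y` at the smallest angle `φ`, and align them with their
partners. The inner products with `x` determine the cloud up to pointwise reflections in the plane
of the axis and `x`; likewise for `y`. On each circle about the axis the difference of
multiplicities is therefore odd about `0` and about `φ`, and by minimality it vanishes between them,
so it is zero (`exists_perm_of_reflections`).

For existence, all input types have at most continuum cardinality, so injections into `ℝ` exist.
Continuous functions that are injective up to size `N` come from sums of monomials over the multiset
(`multiset_eq_of_sum_monomials`). -/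

/-! ### Matching of multisets and functions with two centres of oddness. -/

theorem exists_perm_of_map_univ_eq {ι X : Type*} [Fintype ι] (f g : ι → X)
    (h : (Finset.univ : Finset ι).val.map f = (Finset.univ : Finset ι).val.map g) :
    ∃ τ : Equiv.Perm ι, ∀ i, g (τ i) = f i := by
  classical
  have hcard : ∀ c, Nonempty ({i // f i = c} ≃ {i // g i = c}) := fun c => by
    refine Fintype.card_eq.1 ?_
    have := congrArg (Multiset.count c) h
    rw [Multiset.count_map, Multiset.count_map] at this
    simp only [Fintype.card_subtype, Finset.card_def, Finset.filter_val]
    simpa only [eq_comm] using this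
  exact ⟨Equiv.ofFiberEquiv fun c => (hcard c).some, fun i => Equiv.ofFiberEquiv_map _ i⟩

theorem map_univ_comp_equiv {α β X : Type*} [Fintype α] [Fintype β] (e : α ≃ β) (f : β → X) :
    (Finset.univ : Finset α).val.map (fun i => f (e i)) = (Finset.univ : Finset β).val.map f := by
  rw [← Multiset.map_univ_val_equiv e, Multiset.map_map]
  rfl

/-- An integer-valued function that is odd about `0` and about `φ` and vanishes between these two
points vanishes identically. -/
theorem eq_zero_of_odd_about {g : ℝ → ℤ} {φ : ℝ} (hφ : 0 < φ) (h0 : ∀ θ, g (-θ) = -g θ)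
    (h1 : ∀ θ, g (2 * φ - θ) = -g θ) (h : ∀ θ, 0 < θ → θ < φ → g θ = 0) (θ : ℝ) : g θ = 0 := by
  -- Composing the two point reflections of the line gives the translation by `2 * φ`, and the two
  -- signs cancel.
  have hper : Function.Periodic g (2 * φ) := fun θ => by
    have := h1 (-θ)
    rw [h0, neg_neg] at this
    rw [← this]
    congr 1
    ring
  obtain ⟨y, ⟨hy1, hy2⟩, hy⟩ := hper.exists_mem_Ioc (by positivity) θ (-φ)
  rw [hy]
  -- At the two centres oddness reads `g y = -g y`, which forces zero in `ℤ`.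
  have hpos : ∀ y, 0 ≤ y → y ≤ φ → g y = 0 := fun y hy1 hy2 => by
    rcases hy1.eq_or_lt with rfl | hy1
    · have := h0 0
      rw [neg_zero] at this
      lia
    rcases hy2.eq_or_lt with rfl | hy2
    · have := h1 y
      rw [show 2 * y - y = y by ring] at this
      lia
    exact h y hy1 hy2
  rcases le_total 0 y with h' | h'
  · exact hpos y h' (by linarith)
  · have := hpos (-y) (by linarith) (by linarith)
    rw [h0] at this
    lia

/-! ### Reflections in planes through an axis. -/

/-- Cylindrical coordinates about the first coordinate axis. -/
noncomputable def cylPoint (a r θ : ℝ) : E3 := !₂[a, r * Real.cos θ, r * Real.sin θ]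

/-- The reflection in the plane that contains the first coordinate axis and has angle `φ`. -/
noncomputable def axisReflection (φ : ℝ) (w : E3) : E3 :=
  !₂[w 0, Real.cos (2 * φ) * w 1 + Real.sin (2 * φ) * w 2,
    Real.sin (2 * φ) * w 1 - Real.cos (2 * φ) * w 2]

@[simp] theorem cylPoint_zero (a r θ : ℝ) : cylPoint a r θ 0 = a := rfl
@[simp] theorem cylPoint_one (a r θ : ℝ) : cylPoint a r θ 1 = r * Real.cos θ := rfl
@[simp] theorem cylPoint_two (a r θ : ℝ) : cylPoint a r θ 2 = r * Real.sin θ := rfl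

theorem e3_ext {v w : E3} (h0 : v 0 = w 0) (h1 : v 1 = w 1) (h2 : v 2 = w 2) : v = w := by
  ext i
  fin_cases i
  exacts [h0, h1, h2]

theorem e3_inner (v w : E3) : ⟪v, w⟫ = v 0 * w 0 + v 1 * w 1 + v 2 * w 2 := by
  rw [PiLp.inner_apply, Fin.sum_univ_three]
  simp only [RCLike.inner_apply, conj_trivial]
  ring

theorem e3_norm_sq (v : E3) : ‖v‖ ^ 2 = v 0 ^ 2 + v 1 ^ 2 + v 2 ^ 2 := by
  rw [← real_inner_self_eq_norm_sq, e3_inner]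
  ring

theorem exists_polar (x y : ℝ) :
    ∃ r θ : ℝ, 0 ≤ r ∧ x = r * Real.cos θ ∧ y = r * Real.sin θ :=
  ⟨‖(⟨x, y⟩ : ℂ)‖, Complex.arg ⟨x, y⟩, norm_nonneg _,
    (Complex.norm_mul_cos_arg ⟨x, y⟩).symm, (Complex.norm_mul_sin_arg ⟨x, y⟩).symm⟩

theorem exists_eq_cylPoint (w : E3) : ∃ r θ : ℝ, 0 ≤ r ∧ w = cylPoint (w 0) r θ := by
  obtain ⟨r, θ, hr, h1, h2⟩ := exists_polar (w 1) (w 2)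
  exact ⟨r, θ, hr, e3_ext rfl h1 h2⟩

theorem axisReflection_cylPoint (φ a r θ : ℝ) :
    axisReflection φ (cylPoint a r θ) = cylPoint a r (2 * φ - θ) := by
  apply e3_ext
  · rfl
  · simp only [axisReflection, cylPoint, Real.cos_sub]
    simp
    ring
  · simp only [axisReflection, cylPoint, Real.sin_sub]
    simp
    ring

theorem axisReflection_involutive (φ : ℝ) : Function.Involutive (axisReflection φ) := fun w => by
  obtain ⟨r, θ, -, h⟩ := exists_eq_cylPoint w
  rw [h, axisReflection_cylPoint, axisReflection_cylPoint]
  congr 1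
  ring

theorem inner_cylPoint (a r θ b s η : ℝ) :
    ⟪cylPoint a r θ, cylPoint b s η⟫ = a * b + r * s * Real.cos (θ - η) := by
  rw [e3_inner, Real.cos_sub]
  simp
  ring

theorem norm_sq_cylPoint (a r θ : ℝ) : ‖cylPoint a r θ‖ ^ 2 = a ^ 2 + r ^ 2 := by
  rw [← real_inner_self_eq_norm_sq, inner_cylPoint]
  simp
  ring

/-- Up to the reflection that fixes a vector off the axis, a vector is determined by its first
coordinate, its length and its inner product with that vector. -/
theorem eq_or_eq_axisReflection {α ρ φ : ℝ} (hρ : ρ ≠ 0) {w w' : E3} (h0 : w' 0 = w 0)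
    (hn : ‖w'‖ = ‖w‖) (hi : ⟪cylPoint α ρ φ, w'⟫ = ⟪cylPoint α ρ φ, w⟫) :
    w' = w ∨ w' = axisReflection φ w := by
  obtain ⟨r, θ, hr, h⟩ := exists_eq_cylPoint w
  obtain ⟨r', θ', hr', h'⟩ := exists_eq_cylPoint w'
  rw [h0] at h'
  generalize w 0 = a at h h'
  subst h h'
  have hrr : r' = r := by
    have := congrArg (· ^ 2) hn
    simp only [norm_sq_cylPoint] at this
    nlinarith
  subst hrr
  rw [axisReflection_cylPoint]
  rcases eq_or_ne r' 0 with rfl | hr0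
  · left
    simp [cylPoint]
  rw [inner_cylPoint, inner_cylPoint, add_right_inj] at hi
  -- Off the axis only the cosine of the angle to the plane is known; its two solutions modulo `2π`
  -- are the two alternatives.
  have hc := mul_left_cancel₀ (mul_ne_zero hρ hr0) hi
  obtain ⟨k, hk | hk⟩ := Real.cos_eq_cos_iff.1 hc
  · left
    have : θ = θ' + (-k : ℤ) * (2 * Real.pi) := by push_cast; linarith
    rw [cylPoint, cylPoint, this, Real.cos_add_int_mul_two_pi, Real.sin_add_int_mul_two_pi]
  · right
    have : 2 * φ - θ = θ' + k * (2 * Real.pi) := by linarith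
    rw [cylPoint, cylPoint, this, Real.cos_add_int_mul_two_pi, Real.sin_add_int_mul_two_pi]

/-- Matching two families up to an involution `s` determines the symmetrized multiplicities. -/
theorem card_add_card_eq_of_perm {n : ℕ} {X : Type*} [DecidableEq X] {s : X → X}
    (hs : Function.Involutive s) {p q : Fin n → X} {τ : Equiv.Perm (Fin n)}
    (h : ∀ j, q (τ j) = p j ∨ q (τ j) = s (p j)) (w : X) :
    (Finset.univ.filter fun j => p j = w).card + (Finset.univ.filter fun j => p j = s w).card =
      (Finset.univ.filter fun j => q j = w).card +
        (Finset.univ.filter fun j => q j = s w).card := by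
  have hF : ∀ f : Fin n → X,
      (Finset.univ.filter fun j => f j = w).card + (Finset.univ.filter fun j => f j = s w).card =
        ∑ j, ((if f j = w then 1 else 0) + (if f j = s w then 1 else 0)) := fun f => by
    rw [Finset.sum_add_distrib, Finset.card_filter, Finset.card_filter]
  rw [hF, hF, ← Equiv.sum_comp τ fun j => (if q j = w then 1 else 0) + if q j = s w then 1 else 0]
  refine Finset.sum_congr rfl fun j _ => ?_
  rcases h j with hj | hj
  · rw [hj]
  · have h1 : s (p j) = w ↔ p j = s w := hs.eq_iff
    rw [hj, add_comm]
    simp only [h1, hs.injective.eq_iff]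

/-- Two families of points that agree up to the reflections in two planes through the axis, and
have no points strictly between these planes, agree as multisets. -/
theorem exists_perm_of_reflections {n : ℕ} {p q : Fin n → E3} {φ : ℝ} (hφ : 0 < φ)
    (h0 : ∃ τ : Equiv.Perm (Fin n), ∀ j, q (τ j) = p j ∨ q (τ j) = axisReflection 0 (p j))
    (h1 : ∃ τ : Equiv.Perm (Fin n), ∀ j, q (τ j) = p j ∨ q (τ j) = axisReflection φ (p j))
    (hp : ∀ j a r θ, 0 < r → 0 < θ → θ < φ → p j ≠ cylPoint a r θ)
    (hq : ∀ j a r θ, 0 < r → 0 < θ → θ < φ → q j ≠ cylPoint a r θ) :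
    ∃ σ : Equiv.Perm (Fin n), ∀ j, q (σ j) = p j := by
  classical
  obtain ⟨τ0, h0⟩ := h0
  obtain ⟨τ1, h1⟩ := h1
  have key : ∀ w, (Finset.univ.filter fun j => p j = w).card =
      (Finset.univ.filter fun j => q j = w).card := fun w => by
    obtain ⟨r, θ, hr, hw⟩ := exists_eq_cylPoint w
    generalize w 0 = a at hw
    subst hw
    rcases hr.eq_or_lt with rfl | hr
    -- Points on the axis are fixed by the reflection, so the symmetrized count is twice the
    -- multiplicity.
    · have := card_add_card_eq_of_perm (axisReflection_involutive 0) h0 (cylPoint a 0 θ)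
      rw [axisReflection_cylPoint, show cylPoint a 0 (2 * 0 - θ) = cylPoint a 0 θ by
        simp [cylPoint]] at this
      lia
    have := eq_zero_of_odd_about (g := fun θ =>
      ((Finset.univ.filter fun j => p j = cylPoint a r θ).card : ℤ) -
        (Finset.univ.filter fun j => q j = cylPoint a r θ).card) hφ
      (fun θ => by
        have := card_add_card_eq_of_perm (axisReflection_involutive 0) h0 (cylPoint a r θ)
        rw [axisReflection_cylPoint, show 2 * 0 - θ = -θ by ring] at this
        lia)
      (fun θ => by
        have := card_add_card_eq_of_perm (axisReflection_involutive φ) h1 (cylPoint a r θ)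
        rw [axisReflection_cylPoint] at this
        lia)
      (fun θ h0 h1 => by
        rw [Finset.filter_false_of_mem fun j _ => hp j a r θ hr h0 h1,
          Finset.filter_false_of_mem fun j _ => hq j a r θ hr h0 h1]
        simp) θ
    lia
  apply exists_perm_of_map_univ_eq
  ext w
  rw [Multiset.count_map, Multiset.count_map]
  have := key w
  simp only [Finset.card_def, Finset.filter_val] at this
  simpa only [eq_comm] using this

/-! ### Adapted frames and angles about an axis. -/

/-- A frame adapted to three vectors, in which their coordinates form a triangular matrix with
nonnegative diagonal. -/
theorem exists_adapted_frame (e x y : E3) : ∃ T : E3 ≃ₗᵢ[ℝ] E3,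
    (0 ≤ T e 0 ∧ T e 1 = 0 ∧ T e 2 = 0) ∧ (0 ≤ T x 1 ∧ T x 2 = 0) ∧ 0 ≤ T y 2 := by
  have hd : Module.finrank ℝ E3 = Fintype.card (Fin 3) := by simp
  let f : Fin 3 → E3 := ![e, x, y]
  let b := InnerProductSpace.gramSchmidtOrthonormalBasis hd f
  have hdiag : ∀ i, 0 ≤ b.repr (f i) i := fun i => by
    rw [OrthonormalBasis.repr_apply_apply]
    -- For dependent vectors the basis is completed arbitrarily; the new basis vector is orthogonal
    -- to `f i`, so the diagonal entry is zero.
    by_cases hi : InnerProductSpace.gramSchmidtNormed ℝ f i = 0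
    · exact (InnerProductSpace.inner_gramSchmidtOrthonormalBasis_eq_zero hd hi i).ge
    · rw [InnerProductSpace.gramSchmidtOrthonormalBasis_apply hd hi,
        InnerProductSpace.gramSchmidtNormed, inner_smul_left]
      refine mul_nonneg (by simp) ?_
      have : ⟪InnerProductSpace.gramSchmidt ℝ f i, f i⟫ =
          ⟪InnerProductSpace.gramSchmidt ℝ f i, InnerProductSpace.gramSchmidt ℝ f i⟫ := by
        conv_lhs => rw [InnerProductSpace.gramSchmidt_def'' ℝ f i, inner_add_right, inner_sum]
        rw [Finset.sum_eq_zero, add_zero]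
        intro j hj
        rw [inner_smul_right,
          InnerProductSpace.gramSchmidt_orthogonal ℝ f (Finset.mem_Iio.1 hj).ne', mul_zero]
      rw [this]
      exact real_inner_self_nonneg
  have htri : ∀ i j, i < j → b.repr (f i) j = 0 := fun i j hij =>
    InnerProductSpace.gramSchmidtOrthonormalBasis_inv_triangular' hd f hij
  exact ⟨b.repr, ⟨hdiag 0, htri 0 1 (by decide), htri 0 2 (by decide)⟩,
    ⟨hdiag 1, htri 1 2 (by decide)⟩, hdiag 2⟩

/-- The inner product of the components of `v` and `w` orthogonal to `e`, scaled by `‖e‖ ^ 2`. -/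
noncomputable def axisGram (e v w : E3) : ℝ := ‖e‖ ^ 2 * ⟪v, w⟫ - ⟪e, v⟫ * ⟪e, w⟫

/-- The cosine of the angle between the components of `v` and `w` orthogonal to `e`. -/
noncomputable def axisCos (e v w : E3) : ℝ :=
  axisGram e v w / √(axisGram e v v * axisGram e w w)

section Frame

variable {T : E3 ≃ₗᵢ[ℝ] E3} {e v w : E3} {ρ a r θ b s η : ℝ}

theorem axisGram_eq_of_frame (he : T e = cylPoint ρ 0 0) (hv : T v = cylPoint a r θ)
    (hw : T w = cylPoint b s η) : axisGram e v w = ρ ^ 2 * (r * s * Real.cos (θ - η)) := by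
  rw [axisGram, ← T.inner_map_map v w, ← T.inner_map_map e v, ← T.inner_map_map e w,
    ← T.norm_map e, he, hv, hw, norm_sq_cylPoint, inner_cylPoint, inner_cylPoint, inner_cylPoint]
  ring

theorem axisGram_self_eq_of_frame (he : T e = cylPoint ρ 0 0) (hv : T v = cylPoint a r θ) :
    axisGram e v v = (ρ * r) ^ 2 := by
  rw [axisGram_eq_of_frame he hv hv, sub_self, Real.cos_zero]
  ring

theorem axisCos_eq_of_frame (he : T e = cylPoint ρ 0 0) (hv : T v = cylPoint a r θ)
    (hw : T w = cylPoint b s η) (hρ : 0 < ρ) (hr : 0 < r) (hs : 0 < s) :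
    axisCos e v w = Real.cos (θ - η) := by
  rw [axisCos, axisGram_eq_of_frame he hv hw, axisGram_self_eq_of_frame he hv,
    axisGram_self_eq_of_frame he hw, ← mul_pow, Real.sqrt_sq (by positivity)]
  field_simp

theorem sin_eq_zero_of_parallel (he : T e = cylPoint ρ 0 0) (hv : T v = cylPoint a r θ)
    (hw : T w = cylPoint b s η) (hρ : 0 < ρ) (hr : 0 < r) (hs : 0 < s)
    (h : axisGram e v w ^ 2 = axisGram e v v * axisGram e w w) : Real.sin (θ - η) = 0 := by
  rw [axisGram_eq_of_frame he hv hw, axisGram_self_eq_of_frame he hv,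
    axisGram_self_eq_of_frame he hw] at h
  have h2 : (ρ ^ 2 * (r * s)) ^ 2 * Real.sin (θ - η) ^ 2 = 0 := by
    rw [Real.sin_sq]
    linear_combination -h
  have h3 : (ρ ^ 2 * (r * s)) ^ 2 ≠ 0 := by positivity
  simpa [h3] using h2

theorem parallel_of_sin_eq_zero (he : T e = cylPoint ρ 0 0) (hv : T v = cylPoint a r θ)
    (hw : T w = cylPoint b s η) (h : r * s * Real.sin (θ - η) = 0) :
    axisGram e v w ^ 2 = axisGram e v v * axisGram e w w := by
  rw [axisGram_eq_of_frame he hv hw, axisGram_self_eq_of_frame he hv,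
    axisGram_self_eq_of_frame he hw]
  linear_combination ρ ^ 4 * (r * s) ^ 2 * (Real.sin_sq_add_cos_sq (θ - η)) -
    ρ ^ 4 * (r * s * Real.sin (θ - η)) * h

theorem inner_eq_mul_of_frame (he : T e = cylPoint ρ 0 0) : ⟪e, v⟫ = ρ * T v 0 := by
  rw [← T.inner_map_map, he, e3_inner]
  simp

theorem eq_cylPoint_of_frame (h : 0 ≤ T e 0 ∧ T e 1 = 0 ∧ T e 2 = 0) :
    T e = cylPoint ‖e‖ 0 0 := by
  have := e3_norm_sq (T e)
  rw [T.norm_map, h.2.1, h.2.2] at this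
  have h2 : T e 0 = ‖e‖ := by
    rw [← sq_eq_sq₀ h.1 (norm_nonneg _)]
    linarith
  exact e3_ext h2 (by simp [h.2.1]) (by simp [h.2.2])

end Frame

/-! ### Congruence from colours about an axis. -/

/-- Iterated matching of the points of two clouds by their lengths and their inner products with
the marked vectors `e`, `e'` and with all other points. -/
def AxisMatch {n : ℕ} (p q : Fin n → E3) (e e' : E3) : ℕ → Fin n → Fin n → Prop
  | 0 => fun v v' => ‖p v‖ = ‖q v'‖ ∧ ⟪e, p v⟫ = ⟪e', q v'⟫
  | l + 1 => fun v v' => AxisMatch p q e e' l v v' ∧ ∃ τ : Equiv.Perm (Fin n), ∀ w,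
      AxisMatch p q e e' l w (τ w) ∧ ⟪p v, p w⟫ = ⟪q v', q (τ w)⟫

section Match

variable {n : ℕ} {p q : Fin n → E3} {e e' : E3} {T T' : E3 ≃ₗᵢ[ℝ] E3} {ρ : ℝ}

theorem AxisMatch.base {l : ℕ} {v v' : Fin n} (h : AxisMatch p q e e' l v v') :
    ‖p v‖ = ‖q v'‖ ∧ ⟪e, p v⟫ = ⟪e', q v'⟫ := by
  induction l with
  | zero => exact h
  | succ l ih => exact ih h.1

theorem AxisMatch.frame_zero_eq {l : ℕ} {v v' : Fin n} (h : AxisMatch p q e e' l v v')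
    (hρ : 0 < ρ) (he : T e = cylPoint ρ 0 0) (he' : T' e' = cylPoint ρ 0 0) :
    T' (q v') 0 = T (p v) 0 := by
  have := h.base.2
  rw [inner_eq_mul_of_frame he, inner_eq_mul_of_frame he'] at this
  exact (mul_left_cancel₀ hρ.ne' this).symm

theorem AxisMatch.exists_perm_reflection {l : ℕ} {v v' : Fin n} {α r φ : ℝ}
    (h : AxisMatch p q e e' (l + 1) v v') (hρ : 0 < ρ) (he : T e = cylPoint ρ 0 0)
    (he' : T' e' = cylPoint ρ 0 0) (hv : T (p v) = cylPoint α r φ)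
    (hv' : T' (q v') = cylPoint α r φ) (hr : r ≠ 0) :
    ∃ τ : Equiv.Perm (Fin n), ∀ j,
      T' (q (τ j)) = T (p j) ∨ T' (q (τ j)) = axisReflection φ (T (p j)) := by
  obtain ⟨-, τ, hτ⟩ := h
  refine ⟨τ, fun j => ?_⟩
  obtain ⟨h1, h2⟩ := hτ j
  refine eq_or_eq_axisReflection (α := α) (φ := φ) hr (h1.frame_zero_eq hρ he he') ?_ ?_
  · rw [T.norm_map, T'.norm_map, h1.base.1]
  · rw [← hv, T.inner_map_map, hv, ← hv', T'.inner_map_map, h2]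

/-- The empty sector is required only of `p`, but on both sides of the plane at angle `0`: each
point of `q` is a point of `p` or its mirror image in that plane, so `q` has no point in the sector
either. -/
theorem exists_isometry_of_frames {φ : ℝ} (hφ : 0 < φ)
    (h0 : ∃ τ : Equiv.Perm (Fin n), ∀ j,
      T' (q (τ j)) = T (p j) ∨ T' (q (τ j)) = axisReflection 0 (T (p j)))
    (h1 : ∃ τ : Equiv.Perm (Fin n), ∀ j,
      T' (q (τ j)) = T (p j) ∨ T' (q (τ j)) = axisReflection φ (T (p j)))
    (hp : ∀ j a r θ, 0 < r → 0 < |θ| → |θ| < φ → T (p j) ≠ cylPoint a r θ) :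
    ∃ (σ : Equiv.Perm (Fin n)) (R : E3 ≃ₗᵢ[ℝ] E3), ∀ j, q (σ j) = R (p j) := by
  obtain ⟨σ, hσ⟩ := exists_perm_of_reflections (p := fun j => T (p j)) (q := fun j => T' (q j))
    hφ h0 h1
    (fun j a r θ hr h1 h2 => hp j a r θ hr (by rwa [abs_of_pos h1]) (by rwa [abs_of_pos h1]))
    (fun j a r θ hr h1 h2 hj => by
      obtain ⟨τ, hτ⟩ := h0
      obtain ⟨i, rfl⟩ := τ.surjective j
      rcases hτ i with h | h
      · exact hp i a r θ hr (by rwa [abs_of_pos h1]) (by rwa [abs_of_pos h1]) (h.symm.trans hj)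
      · refine hp i a r (-θ) hr (by rwa [abs_neg, abs_of_pos h1])
          (by rwa [abs_neg, abs_of_pos h1]) ?_
        rw [← axisReflection_involutive 0 (T (p i)), ← h, hj, axisReflection_cylPoint]
        congr 1
        ring)
  exact ⟨σ, T.trans T'.symm, fun j => by
    rw [LinearIsometryEquiv.trans_apply, ← hσ j, T'.symm_apply_apply]⟩

/-- Points that carry the same iterated colours about marked vectors of equal nonzero length form
congruent clouds. -/
theorem exists_isometry_of_axisMatch (hn : ‖e‖ = ‖e'‖) (he0 : e ≠ 0)
    {τ : Equiv.Perm (Fin n)} (hτ : ∀ j, AxisMatch p q e e' 2 j (τ j)) :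
    ∃ (σ : Equiv.Perm (Fin n)) (R : E3 ≃ₗᵢ[ℝ] E3), ∀ j, q (σ j) = R (p j) := by
  have hρ : 0 < ‖e‖ := norm_pos_iff.2 he0
  -- If `p` lies on the axis, equal lengths and equal heights put `q` there too, and `τ` itself
  -- matches the points.
  by_cases hA : ∀ j, axisGram e (p j) (p j) = 0
  · obtain ⟨T, hT, -⟩ := exists_adapted_frame e 0 0
    obtain ⟨T', hT', -⟩ := exists_adapted_frame e' 0 0
    replace hT := eq_cylPoint_of_frame hT
    replace hT' := eq_cylPoint_of_frame hT'
    rw [← hn] at hT'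
    refine ⟨τ, T.trans T'.symm, fun j => ?_⟩
    rw [LinearIsometryEquiv.trans_apply, LinearIsometryEquiv.eq_symm_apply]
    have h0 := (hτ j).frame_zero_eq hρ hT hT'
    have h1 := congrArg (· ^ 2) (hτ j).base.1
    obtain ⟨r, θ, hr, hj⟩ := exists_eq_cylPoint (T (p j))
    have h2 := hA j
    rw [axisGram_self_eq_of_frame hT hj] at h2
    have hr0 : r = 0 := by simpa [hρ.ne'] using h2
    obtain ⟨r', θ', hr', hj'⟩ := exists_eq_cylPoint (T' (q (τ j)))
    rw [← T.norm_map, ← T'.norm_map (q (τ j)), hj, hj', norm_sq_cylPoint, norm_sq_cylPoint, h0, hr0] at h1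
    have hr0' : r' = 0 := by nlinarith
    rw [hj, hj', h0, hr0, hr0']
    simp [cylPoint]
  push Not at hA
  -- Frames adapted to matching points `x`, `x'` and `y`, `y'`.
  have frames : ∀ x x' y y', axisGram e (p x) (p x) ≠ 0 → AxisMatch p q e e' 0 x x' →
      AxisMatch p q e e' 0 y y' → ⟪p x, p y⟫ = ⟪q x', q y'⟫ →
      ∃ (T T' : E3 ≃ₗᵢ[ℝ] E3) (α r β s φ : ℝ), T e = cylPoint ‖e‖ 0 0 ∧
        T' e' = cylPoint ‖e‖ 0 0 ∧ 0 < r ∧ T (p x) = cylPoint α r 0 ∧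
        T' (q x') = cylPoint α r 0 ∧ 0 ≤ s ∧ 0 ≤ φ ∧ φ ≤ Real.pi ∧
        T (p y) = cylPoint β s φ ∧ T' (q y') = cylPoint β s φ := by
    intro x x' y y' hx hxx hyy hxy
    obtain ⟨T, hT, hTx, hTy⟩ := exists_adapted_frame e (p x) (p y)
    obtain ⟨T', hT', hTx', hTy'⟩ := exists_adapted_frame e' (q x') (q y')
    replace hT := eq_cylPoint_of_frame hT
    replace hT' := eq_cylPoint_of_frame hT'
    rw [← hn] at hT'
    have hx0 := hxx.frame_zero_eq hρ hT hT'
    have hy0 := hyy.frame_zero_eq hρ hT hT'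
    have hxe : T (p x) = cylPoint (T (p x) 0) (T (p x) 1) 0 :=
      e3_ext (by simp) (by simp) (by simp [hTx.2])
    have hr : 0 < T (p x) 1 := by
      refine hTx.1.lt_of_ne' fun h => hx ?_
      rw [axisGram_self_eq_of_frame hT hxe, h]
      ring
    have hx1 : T' (q x') 1 = T (p x) 1 := by
      have h1 := congrArg (· ^ 2) hxx.base.1
      rw [← T.norm_map, ← T'.norm_map (q x'), e3_norm_sq, e3_norm_sq, hTx.2, hTx'.2, hx0] at h1
      rw [← sq_eq_sq₀ hTx'.1 hTx.1]
      linarith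
    have hx' : T' (q x') = T (p x) := e3_ext hx0 hx1 (hTx'.2.trans hTx.2.symm)
    have hy1 : T' (q y') 1 = T (p y) 1 := by
      rw [← T.inner_map_map, ← T'.inner_map_map (q x'), e3_inner, e3_inner, hx', hy0, hTx.2] at hxy
      refine mul_left_cancel₀ hr.ne' ?_
      linarith
    have hy2 : T' (q y') 2 = T (p y) 2 := by
      have h1 := congrArg (· ^ 2) hyy.base.1
      rw [← T.norm_map, ← T'.norm_map (q y'), e3_norm_sq, e3_norm_sq, hy0, hy1] at h1
      rw [← sq_eq_sq₀ hTy' hTy]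
      linarith
    have hy' : T' (q y') = T (p y) := e3_ext hy0 hy1 hy2
    let z : ℂ := ⟨T (p y) 1, T (p y) 2⟩
    have hye : T (p y) = cylPoint (T (p y) 0) ‖z‖ z.arg :=
      e3_ext rfl (Complex.norm_mul_cos_arg z).symm (Complex.norm_mul_sin_arg z).symm
    exact ⟨T, T', _, _, _, _, _, hT, hT', hr, hxe, hx'.trans hxe, norm_nonneg _,
      Complex.arg_nonneg_iff.2 hTy, Complex.arg_le_pi z, hye, hy'.trans hye⟩
  -- If the cloud lies in one plane through the axis there is no second plane. The same plane is
  -- then used at angles `0` and `π`.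
  by_cases hB : ∀ x y, axisGram e (p x) (p y) ^ 2 =
      axisGram e (p x) (p x) * axisGram e (p y) (p y)
  · obtain ⟨x, hx⟩ := hA
    have hxx := (hτ x).1.1
    obtain ⟨T, T', α, r, -, -, -, hT, hT', hr, hTx, hTx', -⟩ := frames x (τ x) x (τ x) hx hxx hxx
      (by rw [real_inner_self_eq_norm_sq, real_inner_self_eq_norm_sq, hxx.base.1])
    have h0 := (hτ x).exists_perm_reflection hρ hT hT' hTx hTx' hr.ne'
    have hpi : axisReflection Real.pi = axisReflection 0 := by
      funext w
      simp [axisReflection]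
    refine exists_isometry_of_frames Real.pi_pos h0 (hpi ▸ h0) fun j a s θ hs h1 h2 hj => ?_
    have := sin_eq_zero_of_parallel hT hTx hj hρ hr hs (hB x j)
    rw [zero_sub, Real.sin_neg, neg_eq_zero] at this
    rw [abs_lt] at h2
    exact abs_pos.1 h1 ((Real.sin_eq_zero_iff_of_lt_of_lt h2.1 h2.2).1 this)
  -- A non-parallel pair with minimal angle.
  push Not at hB
  obtain ⟨x₀, y₀, hxy₀⟩ := hB
  obtain ⟨⟨x, y⟩, hxy, hmax⟩ := Finset.exists_max_image
    (Finset.univ.filter fun z : Fin n × Fin n => axisGram e (p z.1) (p z.2) ^ 2 ≠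
      axisGram e (p z.1) (p z.1) * axisGram e (p z.2) (p z.2))
    (fun z => axisCos e (p z.1) (p z.2)) ⟨(x₀, y₀), by simpa using hxy₀⟩
  simp only [Finset.mem_filter, Finset.mem_univ, true_and, Prod.forall] at hxy hmax
  -- A point on the axis is parallel, in this sense, to every other point.
  have hx : axisGram e (p x) (p x) ≠ 0 := fun h => by
    obtain ⟨T, hT, -⟩ := exists_adapted_frame e 0 0
    replace hT := eq_cylPoint_of_frame hT
    obtain ⟨r, θ, hr, hj⟩ := exists_eq_cylPoint (T (p x))
    obtain ⟨s, η, hs, hk⟩ := exists_eq_cylPoint (T (p y))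
    rw [axisGram_self_eq_of_frame hT hj] at h
    have hr0 : r = 0 := by simpa [hρ.ne'] using h
    exact hxy (parallel_of_sin_eq_zero hT hj hk (by rw [hr0]; ring))
  -- The partner of `y` is `κ y` rather than `τ y`, since its inner product with the partner of `x`
  -- must agree. Passing from `x` to `y` costs one round, and one is left for the reflections at
  -- `y`.
  obtain ⟨κ, hκ⟩ := (hτ x).2
  obtain ⟨hyy, hin⟩ := hκ y
  obtain ⟨T, T', α, r, β, s, φ, hT, hT', hr, hTx, hTx', hs, hφ0, hφπ, hTy, hTy'⟩ :=
    frames x (τ x) y (κ y) hx (hτ x).1.1 hyy.1 hin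
  have hne : s * Real.sin φ ≠ 0 := fun h => hxy <| parallel_of_sin_eq_zero hT hTx hTy (by
    rw [zero_sub, Real.sin_neg]
    linear_combination -r * h)
  have hs0 : 0 < s := hs.lt_of_ne' (left_ne_zero_of_mul hne)
  have hφ : 0 < φ := hφ0.lt_of_ne' fun h => hne (by simp [h])
  refine exists_isometry_of_frames hφ ((hτ x).exists_perm_reflection hρ hT hT' hTx hTx' hr.ne')
    (hyy.exists_perm_reflection hρ hT hT' hTy hTy' hs0.ne') fun j a t θ ht h1 h2 hj => ?_
  -- A point inside the sector would form with `x` a non-parallel pair with larger cosine.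
  refine (hmax x j fun h => ?_).not_gt ?_
  · have := sin_eq_zero_of_parallel hT hTx hj hρ hr ht h
    rw [zero_sub, Real.sin_neg, neg_eq_zero] at this
    have h3 := abs_lt.1 (h2.trans_le hφπ)
    exact abs_pos.1 h1 ((Real.sin_eq_zero_iff_of_lt_of_lt h3.1 h3.2).1 this)
  · rw [axisCos_eq_of_frame hT hTx hTy hρ hr hs0, axisCos_eq_of_frame hT hTx hj hρ hr ht,
      zero_sub, zero_sub, Real.cos_neg, Real.cos_neg, ← Real.cos_abs θ]
    exact Real.cos_lt_cos_of_nonneg_of_le_pi h1.le hφπ h2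

end Match

/-! ### Colour refinement recovers the geometry relative to the barycenter. -/

/-- Iterated matching of the points of two clouds with marked points `u`, `u'`: colour refinement
on the complete distance graph. -/
def RefineMatch {n : ℕ} (P Q : PointCloud n) (u u' : Fin n) : ℕ → Fin n → Fin n → Prop
  | 0 => fun v v' => u = v ↔ u' = v'
  | l + 1 => fun v v' => RefineMatch P Q u u' l v v' ∧ ∃ τ : Equiv.Perm (Fin n), ∀ w,
      RefineMatch P Q u u' l w (τ w) ∧ dist (P v) (P w) = dist (Q v') (Q (τ w))

/-- The cloud translated so that its barycenter is the origin. -/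
noncomputable def PointCloud.centered {n : ℕ} (P : PointCloud n) : PointCloud n :=
  fun i => P i - (n : ℝ)⁻¹ • ∑ j, P j

theorem PointCloud.sum_centered {n : ℕ} (hn : n ≠ 0) (P : PointCloud n) :
    ∑ i, P.centered i = 0 := by
  simp only [PointCloud.centered, Finset.sum_sub_distrib, Finset.sum_const, Finset.card_univ,
    Fintype.card_fin, ← Nat.cast_smul_eq_nsmul ℝ, smul_smul]
  rw [mul_inv_cancel₀ (by exact_mod_cast hn), one_smul, sub_self]

theorem PointCloud.dist_eq_norm_centered {n : ℕ} (P : PointCloud n) (i j : Fin n) :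
    dist (P i) (P j) = ‖P.centered i - P.centered j‖ := by
  rw [PointCloud.centered, PointCloud.centered, sub_sub_sub_cancel_right, dist_eq_norm]

/-- The cross terms cancel because the centered points sum to zero. -/
theorem PointCloud.sum_sq_dist {n : ℕ} (hn : n ≠ 0) (P : PointCloud n) (i : Fin n) :
    ∑ j, dist (P i) (P j) ^ 2 = n * ‖P.centered i‖ ^ 2 + ∑ j, ‖P.centered j‖ ^ 2 := by
  simp only [P.dist_eq_norm_centered, norm_sub_sq_real, Finset.sum_add_distrib,
    Finset.sum_sub_distrib, ← Finset.mul_sum, ← inner_sum, P.sum_centered hn]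
  simp

theorem inner_eq_of_norm_sub {v w v' w' : E3} (hv : ‖v‖ = ‖v'‖) (hw : ‖w‖ = ‖w'‖)
    (h : ‖v - w‖ = ‖v' - w'‖) : ⟪v, w⟫ = ⟪v', w'⟫ := by
  have h1 := norm_sub_sq_real v w
  have h2 := norm_sub_sq_real v' w'
  rw [hv, hw, h] at h1
  linarith

section Refine

variable {n : ℕ} {P Q : PointCloud n} {u u' v v' : Fin n}

theorem RefineMatch.of_le {k l : ℕ} (h : RefineMatch P Q u u' l v v') (hkl : k ≤ l) :
    RefineMatch P Q u u' k v v' := by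
  induction l, hkl using Nat.le_induction with
  | base => exact h
  | succ l _ ih => exact ih h.1

theorem RefineMatch.exists_perm {l : ℕ} (h : RefineMatch P Q u u' (l + 1) v v') :
    ∃ τ : Equiv.Perm (Fin n), τ u = u' ∧ ∀ w,
      RefineMatch P Q u u' l w (τ w) ∧ dist (P v) (P w) = dist (Q v') (Q (τ w)) := by
  obtain ⟨-, τ, hτ⟩ := h
  exact ⟨τ, (((hτ u).1.of_le (Nat.zero_le l)).1 rfl).symm, hτ⟩

theorem RefineMatch.dist_eq {l : ℕ} (h : RefineMatch P Q u u' (l + 1) v v') :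
    dist (P v) (P u) = dist (Q v') (Q u') := by
  obtain ⟨τ, hu, hτ⟩ := h.exists_perm
  rw [(hτ u).2, hu]

theorem RefineMatch.norm_sq_add {l : ℕ} (h : RefineMatch P Q u u' (l + 1) v v') :
    n * ‖P.centered v‖ ^ 2 + ∑ j, ‖P.centered j‖ ^ 2 =
      n * ‖Q.centered v'‖ ^ 2 + ∑ j, ‖Q.centered j‖ ^ 2 := by
  obtain ⟨τ, -, hτ⟩ := h.exists_perm
  have hn : n ≠ 0 := by
    rintro rfl
    exact u.elim0
  rw [← P.sum_sq_dist hn, ← Q.sum_sq_dist hn, ← Equiv.sum_comp τ fun w => dist (Q v') (Q w) ^ 2]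
  exact Finset.sum_congr rfl fun w _ => by rw [(hτ w).2]

/-- One round gives the sum of squared distances from a point, hence its norm up to a constant of
the cloud. Summing over the matching from the second round shows that the two constants agree. -/
theorem RefineMatch.norm_eq {l : ℕ} (h : RefineMatch P Q u u' (l + 2) v v') :
    ‖P.centered u‖ = ‖Q.centered u'‖ ∧ ‖P.centered v‖ = ‖Q.centered v'‖ := by
  have hn : (0 : ℝ) < n := by exact_mod_cast u.pos
  obtain ⟨τ, hu, hτ⟩ := h.exists_perm
  have hsum : ∑ j, ‖P.centered j‖ ^ 2 = ∑ j, ‖Q.centered j‖ ^ 2 := by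
    have h1 := Finset.sum_congr (rfl : Finset.univ = Finset.univ)
      fun w (_ : w ∈ Finset.univ) => (hτ w).1.norm_sq_add
    have h2 := Equiv.sum_comp τ
      fun w => (n : ℝ) * ‖Q.centered w‖ ^ 2 + ∑ j, ‖Q.centered j‖ ^ 2
    rw [h2] at h1
    simp only [Finset.sum_add_distrib, ← Finset.mul_sum, Finset.sum_const, Finset.card_univ,
      Fintype.card_fin, nsmul_eq_mul] at h1
    refine mul_left_cancel₀ hn.ne' ?_
    linarith
  have key : ∀ {w w'}, RefineMatch P Q u u' (l + 1) w w' →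
      ‖P.centered w‖ = ‖Q.centered w'‖ := fun h => by
    have := h.norm_sq_add
    rw [hsum, add_left_inj] at this
    rw [← sq_eq_sq₀ (norm_nonneg _) (norm_nonneg _)]
    exact mul_left_cancel₀ hn.ne' this
  exact ⟨hu ▸ key (hτ u).1, key h.1⟩

theorem RefineMatch.axisMatch {l : ℕ} (h : RefineMatch P Q u u' (l + 2) v v') :
    AxisMatch P.centered Q.centered (P.centered u) (Q.centered u') l v v' := by
  induction l generalizing v v' with
  | zero =>
    refine ⟨h.norm_eq.2, inner_eq_of_norm_sub h.norm_eq.1 h.norm_eq.2 ?_⟩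
    rw [norm_sub_rev, ← P.dist_eq_norm_centered, h.dist_eq, Q.dist_eq_norm_centered, norm_sub_rev]
  | succ l ih =>
    obtain ⟨τ, -, hτ⟩ := h.exists_perm
    refine ⟨ih h.1, τ, fun w => ⟨ih (hτ w).1, ?_⟩⟩
    refine inner_eq_of_norm_sub h.norm_eq.2 (hτ w).1.norm_eq.2 ?_
    rw [← P.dist_eq_norm_centered, ← Q.dist_eq_norm_centered, (hτ w).2]

theorem isomorphic_of_centered {σ : Equiv.Perm (Fin n)} {R : E3 ≃ₗᵢ[ℝ] E3}
    (h : ∀ j, Q.centered (σ j) = R (P.centered j)) : P.Isomorphic Q := by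
  refine ⟨σ, R, (n : ℝ)⁻¹ • ∑ j, Q j - R ((n : ℝ)⁻¹ • ∑ j, P j), fun j => ?_⟩
  have := h j
  rw [PointCloud.centered, PointCloud.centered, map_sub, sub_eq_iff_eq_add] at this
  rw [this]
  abel

/-- Five rounds: one to match all points at once, two for the norms, two for the reflections about
the axis. If every point of `P` is at the barycenter there is no axis, but the norms show that `Q`
is equally degenerate. -/
theorem isomorphic_of_refineMatch
    (h : ∀ u v : Fin n, ∃ u' v', RefineMatch P Q u u' 5 v v') : P.Isomorphic Q := by
  by_cases h0 : ∀ u, P.centered u = 0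
  · refine isomorphic_of_centered (σ := 1) (R := 1) fun j => ?_
    obtain ⟨u', v', huv⟩ := h j j
    obtain ⟨τ, -, hτ⟩ := huv.exists_perm
    obtain ⟨i, hi⟩ := τ.surjective j
    have := (hτ i).1.norm_eq.2
    rw [h0, norm_zero, hi, eq_comm, norm_eq_zero] at this
    simpa [h0] using this
  · push Not at h0
    obtain ⟨u, hu⟩ := h0
    obtain ⟨u', v', huv⟩ := h u u
    obtain ⟨τ, -, hτ⟩ := huv.exists_perm
    obtain ⟨σ, R, hR⟩ := exists_isometry_of_axisMatch huv.norm_eq.1 hu fun j => (hτ j).1.axisMatch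
    exact isomorphic_of_centered hR

end Refine

/-! ### From model features to colour refinement, and invariance. -/

theorem subNeighbors_top {n : ℕ} (P : PointCloud n) (u v : Fin n) :
    subNeighbors ⊤ ⊤ P u v = Finset.univ := by
  simp [subNeighbors, subVertices, IsDistEdge]

theorem Agg.size_apply_le {X : Type} {n : ℕ} (P : PointCloud n) (h : Fin n → Fin n → X)
    (u v : Fin n) (a : Agg) : a.size (a.apply ⊤ ⊤ P h u v) ≤ n := by
  cases a <;> simp [Agg.size, Agg.apply, subNeighbors_top]

namespace GeoA

variable {B : Set Agg} {L : ℕ} {M : GeoA B L} {N : ℕ∞} {n : ℕ} {P Q : PointCloud n}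

theorem IsInjectiveUpTo.layer_input_eq (hM : M.IsInjectiveUpTo N) (hn : (n : ℕ∞) ≤ N) {l : ℕ}
    (hl : l < L) {u v u' v' : Fin n}
    (h : M.feature ⊤ ⊤ P (l + 1) u v = M.feature ⊤ ⊤ Q (l + 1) u' v') :
    M.feature ⊤ ⊤ P l u v = M.feature ⊤ ⊤ Q l u' v' ∧ ∀ a ∈ B,
      a.apply ⊤ ⊤ P (M.feature ⊤ ⊤ P l) u v = a.apply ⊤ ⊤ Q (M.feature ⊤ ⊤ Q l) u' v' := by
  have := hM.2.1 l hl
    (fun a => le_trans (by exact_mod_cast Agg.size_apply_le P _ u v a.1) hn)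
    (fun a => le_trans (by exact_mod_cast Agg.size_apply_le Q _ u' v' a.1) hn) h
  exact ⟨congrArg Prod.fst this, fun a ha => congrFun (congrArg Prod.snd this) ⟨a, ha⟩⟩

theorem IsInjectiveUpTo.refineMatch_localU (hM : M.IsInjectiveUpTo N) (hn : (n : ℕ∞) ≤ N)
    (hB : Agg.localU ∈ B) {u u' : Fin n} {l : ℕ} (hl : l ≤ L) {v v' : Fin n}
    (h : M.feature ⊤ ⊤ P l u v = M.feature ⊤ ⊤ Q l u' v') : RefineMatch P Q u u' l v v' := by
  induction l generalizing v v' with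
  | zero => simpa [RefineMatch] using hM.1 h
  | succ l ih =>
    obtain ⟨h1, h2⟩ := hM.layer_input_eq hn hl h
    have h3 := h2 _ hB
    simp only [Agg.apply, subNeighbors_top] at h3
    obtain ⟨τ, hτ⟩ := exists_perm_of_map_univ_eq _ _ h3
    refine ⟨ih (by lia) h1, τ, fun w => ?_⟩
    have := Prod.ext_iff.1 (hτ w)
    exact ⟨ih (by lia) this.1.symm, this.2.symm⟩

/-- Here the second index is the marked point and the first is refined, so the roles in the feature
are swapped. -/
theorem IsInjectiveUpTo.refineMatch_localV (hM : M.IsInjectiveUpTo N) (hn : (n : ℕ∞) ≤ N)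
    (hB : Agg.localV ∈ B) {u u' : Fin n} {l : ℕ} (hl : l ≤ L) {v v' : Fin n}
    (h : M.feature ⊤ ⊤ P l v u = M.feature ⊤ ⊤ Q l v' u') : RefineMatch P Q u u' l v v' := by
  induction l generalizing v v' with
  | zero =>
    have := hM.1 h
    simp only [decide_eq_decide] at this
    simpa only [RefineMatch, eq_comm] using this
  | succ l ih =>
    obtain ⟨h1, h2⟩ := hM.layer_input_eq hn hl h
    have h3 := h2 _ hB
    simp only [Agg.apply, subNeighbors_top] at h3
    obtain ⟨τ, hτ⟩ := exists_perm_of_map_univ_eq _ _ h3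
    refine ⟨ih (by lia) h1, τ, fun w => ?_⟩
    have := Prod.ext_iff.1 (hτ w)
    exact ⟨ih (by lia) this.1.symm, this.2.symm⟩

theorem IsInjectiveUpTo.exists_feature_eq (hM : M.IsInjectiveUpTo N) (hn : (n : ℕ∞) ≤ N)
    {pool : Pooling} (h : M.output ⊤ ⊤ pool n P = M.output ⊤ ⊤ pool n Q) (u v : Fin n) :
    ∃ u' v', M.feature ⊤ ⊤ P L u v = M.feature ⊤ ⊤ Q L u' v' := by
  have key : ∀ f g : Fin n → Fin n → Vec (M.featDim L),
      M.fOuter ((Finset.univ : Finset (Fin n)).val.map fun i =>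
        M.fInner ((Finset.univ : Finset (Fin n)).val.map fun j => f i j)) =
      M.fOuter ((Finset.univ : Finset (Fin n)).val.map fun i =>
        M.fInner ((Finset.univ : Finset (Fin n)).val.map fun j => g i j)) →
      ∀ i j, ∃ i' j', f i j = g i' j' := fun f g hfg i j => by
    obtain ⟨σ, hσ⟩ := exists_perm_of_map_univ_eq _ _
      (hM.2.2.2 (by simpa using hn) (by simpa using hn) hfg)
    obtain ⟨τ, hτ⟩ := exists_perm_of_map_univ_eq _ _
      (hM.2.2.1 (by simpa using hn) (by simpa using hn) (hσ i))
    exact ⟨σ i, τ.symm j, by rw [← hτ, τ.apply_symm_apply]⟩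
  cases pool with
  | VS => exact key _ _ h u v
  | SV =>
    obtain ⟨v', u', h'⟩ := key _ _ h v u
    exact ⟨u', v', h'⟩

theorem IsInjectiveUpTo.size_eq (hM : M.IsInjectiveUpTo N) {n m : ℕ} (hn : (n : ℕ∞) ≤ N)
    (hm : (m : ℕ∞) ≤ N) {pool : Pooling} {P : PointCloud n} {Q : PointCloud m}
    (h : M.output ⊤ ⊤ pool n P = M.output ⊤ ⊤ pool m Q) : n = m := by
  cases pool <;>
  simpa using congrArg Multiset.card (hM.2.2.2 (by simpa using hn) (by simpa using hm) h)

theorem feature_eq_of_isometry (M : GeoA B L) {σ : Equiv.Perm (Fin n)} {R : E3 ≃ₗᵢ[ℝ] E3} {t : E3}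
    (h : ∀ i, Q (σ i) = R (P i) + t) (l : ℕ) (u v : Fin n) :
    M.feature ⊤ ⊤ P l u v = M.feature ⊤ ⊤ Q l (σ u) (σ v) := by
  have hd : ∀ i j, dist (P i) (P j) = dist (Q (σ i)) (Q (σ j)) := fun i j => by
    rw [h, h, dist_add_right, R.dist_map]
  induction l generalizing u v with
  | zero => simp [feature]
  | succ l ih =>
    simp only [feature]
    congr 2
    · exact ih u v
    · funext a
      cases a.1 <;>
        simp only [Agg.apply, subNeighbors_top, ih, hd]
      · rfl
      · rfl
      · rfl
      · exact map_univ_comp_equiv σ fun w => M.feature ⊤ ⊤ Q l (σ u) w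
      · exact map_univ_comp_equiv σ fun w => M.feature ⊤ ⊤ Q l w (σ v)
      · exact map_univ_comp_equiv σ fun w =>
          (M.feature ⊤ ⊤ Q l (σ u) w, dist (Q (σ v)) (Q w))
      · exact map_univ_comp_equiv σ fun w =>
          (M.feature ⊤ ⊤ Q l w (σ v), dist (Q (σ u)) (Q w))

theorem output_eq_of_isometry (M : GeoA B L) {σ : Equiv.Perm (Fin n)} {R : E3 ≃ₗᵢ[ℝ] E3} {t : E3}
    (h : ∀ i, Q (σ i) = R (P i) + t) (pool : Pooling) :
    M.output ⊤ ⊤ pool n P = M.output ⊤ ⊤ pool n Q := by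
  have key : ∀ f g : Fin n → Fin n → Vec (M.featDim L), (∀ i j, f i j = g (σ i) (σ j)) →
      M.fOuter ((Finset.univ : Finset (Fin n)).val.map fun i =>
        M.fInner ((Finset.univ : Finset (Fin n)).val.map fun j => f i j)) =
      M.fOuter ((Finset.univ : Finset (Fin n)).val.map fun i =>
        M.fInner ((Finset.univ : Finset (Fin n)).val.map fun j => g i j)) := fun f g hfg => by
    simp only [hfg]
    rw [← map_univ_comp_equiv σ fun i =>
      M.fInner ((Finset.univ : Finset (Fin n)).val.map fun j => g i j)]
    congr 2
    funext i
    rw [← map_univ_comp_equiv σ fun j => g (σ i) j]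
  cases pool with
  | VS => exact key _ _ (M.feature_eq_of_isometry h L)
  | SV => exact key _ _ fun v u => M.feature_eq_of_isometry h L u v

theorem IsInjectiveUpTo.isE3CompleteUpTo (hM : M.IsInjectiveUpTo N) (hL : 5 ≤ L)
    (hB : Agg.localU ∈ B ∨ Agg.localV ∈ B) (pool : Pooling) :
    IsE3CompleteUpTo N (M.output ⊤ ⊤ pool) := by
  intro n m _ hn _ hm P Q
  refine ⟨fun ⟨σ, R, t, h⟩ => ?_, fun hPQ h => hPQ ?_⟩
  · obtain rfl : n = m := by simpa using Fintype.card_congr σ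
    exact M.output_eq_of_isometry h pool
  · obtain rfl := hM.size_eq hn hm h
    refine isomorphic_of_refineMatch fun u v => ?_
    rcases hB with hB | hB
    · obtain ⟨u', v', h'⟩ := hM.exists_feature_eq hn h u v
      exact ⟨u', v', (hM.refineMatch_localU hn hB le_rfl h').of_le hL⟩
    · obtain ⟨v', u', h'⟩ := hM.exists_feature_eq hn h v u
      exact ⟨u', v', (hM.refineMatch_localV hn hB le_rfl h').of_le hL⟩

end GeoA

/-! ### Existence of injective and of continuous models. -/

instance : Finite Agg :=
  Finite.of_surjective ![Agg.pointUU, .pointVV, .pointVU, .globalU, .globalV, .localU, .localV]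
    fun a => by
      cases a
      exacts [⟨0, rfl⟩, ⟨1, rfl⟩, ⟨2, rfl⟩, ⟨3, rfl⟩, ⟨4, rfl⟩, ⟨5, rfl⟩, ⟨6, rfl⟩]

/-- The feature dimensions of a model whose layers turn dimension `d` into dimension `k d`. -/
def iterDim (k : ℕ → ℕ) : ℕ → ℕ
  | 0 => 1
  | l + 1 => k (iterDim k l)

theorem exists_injective_bool_vec : ∃ f : Bool → Vec 1, Function.Injective f := by
  refine ⟨fun b _ => if b then 1 else 0, fun b c h => ?_⟩
  have := congrFun h 0
  cases b <;> cases c <;> simp at this ⊢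

/-- Layer and pooling functions that exist in every dimension can be composed to a model. -/
theorem exists_model (B : Set Agg) (L : ℕ) (N : ℕ∞)
    (layerProp : ∀ d k : ℕ, (LayerInput B (Vec d) → Vec k) → Prop)
    (poolProp : ∀ d k : ℕ, (Multiset (Vec d) → Vec k) → Prop)
    (hlayer : ∀ d, ∃ (k : ℕ) (f : LayerInput B (Vec d) → Vec k), layerProp d k f ∧
      Set.InjOn f {x | ∀ a : B, (a.1.size (x.2 a) : ℕ∞) ≤ N})
    (hpool : ∀ d, ∃ (k : ℕ) (f : Multiset (Vec d) → Vec k), poolProp d k f ∧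
      Set.InjOn f {s | (Multiset.card s : ℕ∞) ≤ N}) :
    ∃ M : GeoA B L, M.IsInjectiveUpTo N ∧ (∀ l, layerProp _ _ (M.fLayer l)) ∧
      poolProp _ _ M.fInner ∧ poolProp _ _ M.fOuter := by
  choose k f hf hfi using hlayer
  choose k' g hg hgi using hpool
  obtain ⟨init, hinit⟩ := exists_injective_bool_vec
  let M : GeoA B L :=
    { featDim := iterDim k
      poolDim := k' (iterDim k L)
      outDim := k' (k' (iterDim k L))
      fInit := init
      fLayer := fun l => f (iterDim k l)
      fInner := g (iterDim k L)
      fOuter := g (k' (iterDim k L)) }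
  exact ⟨M, ⟨hinit, fun l _ => hfi (iterDim k l), hgi (iterDim k L), hgi (k' (iterDim k L))⟩,
    fun l => hf (iterDim k l), hg (iterDim k L), hg (k' (iterDim k L))⟩

section Cardinality

open Cardinal

theorem mk_vec_le_continuum (d : ℕ) : #(Vec d) ≤ 𝔠 := by
  simpa [mk_real] using power_nat_le (c := 𝔠) (n := d) aleph0_le_continuum

theorem mk_multiset_le_continuum {X : Type} (h : #X ≤ 𝔠) : #(Multiset X) ≤ 𝔠 :=
  (mk_le_of_surjective (f := fun l : List X => (l : Multiset X)) Quot.mk_surjective).trans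
    ((mk_list_le_max X).trans (max_le aleph0_le_continuum h))

theorem mk_prod_le_continuum {X Y : Type} (hX : #X ≤ 𝔠) (hY : #Y ≤ 𝔠) : #(X × Y) ≤ 𝔠 := by
  rw [← mul_def, ← continuum_mul_self]
  exact mul_le_mul' hX hY

theorem Agg.mk_val_le_continuum {X : Type} (h : #X ≤ 𝔠) (a : Agg) : #(Agg.Val X a) ≤ 𝔠 := by
  cases a
  exacts [h, h, h, mk_multiset_le_continuum h, mk_multiset_le_continuum h,
    mk_multiset_le_continuum (mk_prod_le_continuum h mk_real.le),
    mk_multiset_le_continuum (mk_prod_le_continuum h mk_real.le)]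

theorem mk_layerInput_le_continuum {B : Set Agg} {X : Type} (h : #X ≤ 𝔠) :
    #(LayerInput B X) ≤ 𝔠 := by
  refine mk_prod_le_continuum h ?_
  rw [mk_pi]
  refine (prod_le_prod _ (fun _ : B => 𝔠) fun a => Agg.mk_val_le_continuum h a.1).trans ?_
  rw [prod_const]
  simp only [lift_id]
  -- A product of countably many factors of size at most `𝔠` still has size at most `𝔠`.
  refine le_of_le_of_eq ?_ continuum_power_aleph0
  exact power_le_power_left continuum_ne_zero (mk_le_aleph0 (α := B))

theorem exists_injective_vec {X : Type} (h : #X ≤ 𝔠) :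
    ∃ (k : ℕ) (f : X → Vec k), Function.Injective f := by
  rw [← mk_real] at h
  obtain ⟨f⟩ := h
  exact ⟨1, fun x _ => f x, fun x y hxy => f.injective (congrFun hxy 0)⟩

end Cardinality

/-- Some continuous map to a finite-dimensional vector space is injective on `S`. -/
def HasContinuousInjOn {X : Type} [TopologicalSpace X] (S : Set X) : Prop :=
  ∃ (k : ℕ) (f : X → Vec k), Continuous f ∧ Set.InjOn f S

section Continuous

theorem HasContinuousInjOn.of_fintype {X ι : Type} [TopologicalSpace X] [Fintype ι] {S : Set X}
    (f : X → ι → ℝ) (hf : Continuous f) (hi : Set.InjOn f S) : HasContinuousInjOn S := by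
  let e := Fintype.equivFin ι
  refine ⟨Fintype.card ι, fun x j => f x (e.symm j), by fun_prop, fun x hx y hy h => hi hx hy ?_⟩
  funext i
  simpa using congrFun h (e i)

theorem hasContinuousInjOn_vec (d : ℕ) (S : Set (Vec d)) : HasContinuousInjOn S :=
  ⟨d, id, continuous_id, Set.injOn_id _⟩

theorem HasContinuousInjOn.prod {X Y : Type} [TopologicalSpace X] [TopologicalSpace Y] {S : Set X}
    {T : Set Y} (hS : HasContinuousInjOn S) (hT : HasContinuousInjOn T) :
    HasContinuousInjOn (S ×ˢ T) := by
  obtain ⟨k, f, hf, hfi⟩ := hS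
  obtain ⟨k', g, hg, hgi⟩ := hT
  refine .of_fintype (ι := Fin k ⊕ Fin k') (fun x => Sum.elim (f x.1) (g x.2)) ?_ ?_
  · refine continuous_pi fun i => ?_
    cases i <;> simp only [Sum.elim_inl, Sum.elim_inr] <;> fun_prop
  · intro x hx y hy h
    exact Prod.ext (hfi hx.1 hy.1 (funext fun i => congrFun h (Sum.inl i)))
      (hgi hx.2 hy.2 (funext fun i => congrFun h (Sum.inr i)))

theorem HasContinuousInjOn.pi {ι : Type} [Finite ι] {X : ι → Type} [∀ i, TopologicalSpace (X i)]
    {S : ∀ i, Set (X i)} (h : ∀ i, HasContinuousInjOn (S i)) :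
    HasContinuousInjOn {x : ∀ i, X i | ∀ i, x i ∈ S i} := by
  have := Fintype.ofFinite ι
  choose k f hf hfi using h
  refine .of_fintype (ι := Σ i, Fin (k i)) (fun x j => f j.1 (x j.1) j.2) ?_ ?_
  · refine continuous_pi fun j => ?_
    have := hf j.1
    fun_prop
  · intro x hx y hy h
    funext i
    exact hfi i (hx i) (hy i) (funext fun j => congrFun h ⟨i, j⟩)

/-- By the quotient topology continuity is tested on lists, where the empty list is isolated and a
neighbourhood of `a :: l` is a product of neighbourhoods. -/
theorem continuous_multiset_sum_map {X : Type} [TopologicalSpace X] {g : X → ℝ}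
    (hg : Continuous g) : Continuous fun s : Multiset X => (s.map g).sum := by
  refine continuous_coinduced_dom.2 (continuous_iff_continuousAt.2 fun l => ?_)
  simp only [Function.comp_def, Multiset.map_coe, Multiset.sum_coe]
  induction l with
  | nil =>
    rw [ContinuousAt, nhds_nil]
    exact tendsto_pure_nhds _ _
  | cons a l ih =>
    simp only [ContinuousAt, List.map_cons, List.sum_cons] at ih ⊢
    refine List.tendsto_cons_iff.2 ?_
    simp only [List.map_cons, List.sum_cons]
    exact (hg.continuousAt.tendsto.comp Filter.tendsto_fst).add (ih.comp Filter.tendsto_snd)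

theorem multiset_sum_map_eval {d : ℕ} {X : Type} (f : X → Vec d) (s : Multiset X)
    (p : MvPolynomial (Fin d) ℝ) :
    (s.map fun x => MvPolynomial.eval (f x) p).sum =
      ∑ α ∈ p.support, p.coeff α * (s.map fun x => ∏ i, f x i ^ α i).sum := by
  induction s using Multiset.induction with
  | empty => simp
  | cons a s ih =>
    simp only [Multiset.map_cons, Multiset.sum_cons, ih, mul_add, Finset.sum_add_distrib,
      MvPolynomial.eval_eq' (f a)]

/-- Two finite multisets are equal if all monomials of sufficiently high degree have the same sum
over both. -/
theorem multiset_eq_of_sum_monomials {d N : ℕ} {X : Type} {f : X → Vec d}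
    (hf : Function.Injective f) {s t : Multiset X} (hs : Multiset.card s ≤ N)
    (ht : Multiset.card t ≤ N)
    (h : ∀ α : Fin d → Fin (2 * N + 1), (s.map fun x => ∏ i, f x i ^ (α i : ℕ)).sum =
      (t.map fun x => ∏ i, f x i ^ (α i : ℕ)).sum) : s = t := by
  classical
  have hp : ∀ p : MvPolynomial (Fin d) ℝ, p.totalDegree ≤ 2 * N →
      (s.map fun x => MvPolynomial.eval (f x) p).sum =
        (t.map fun x => MvPolynomial.eval (f x) p).sum := fun p hp => by
    rw [multiset_sum_map_eval, multiset_sum_map_eval]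
    refine Finset.sum_congr rfl fun α hα => ?_
    congr 1
    exact h fun i => ⟨α i, Nat.lt_succ_of_le (((MvPolynomial.monomial_le_degreeOf i hα).trans
      (MvPolynomial.degreeOf_le_totalDegree p i)).trans hp)⟩
  ext x₀
  -- The product of such affine factors over the other points of `s + t`, at most `2 * N` of them,
  -- isolates `x₀`: its sum over a multiset is the multiplicity of `x₀` times a nonzero constant.
  have hsep : ∀ y, y ≠ x₀ → ∃ q : MvPolynomial (Fin d) ℝ, q.totalDegree ≤ 1 ∧
      MvPolynomial.eval (f y) q = 0 ∧ MvPolynomial.eval (f x₀) q ≠ 0 := fun y hy => by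
    obtain ⟨i, hi⟩ := Function.ne_iff.1 (hf.ne hy)
    refine ⟨MvPolynomial.X i - MvPolynomial.C (f y i), ?_, by simp, ?_⟩
    · exact (MvPolynomial.totalDegree_sub_C_le _ _).trans (MvPolynomial.totalDegree_X i).le
    · simpa [sub_eq_zero] using hi.symm
  choose! ℓ hℓ using hsep
  let U := (s + t).toFinset.erase x₀
  let p := ∏ y ∈ U, ℓ y
  have hU : U.card ≤ 2 * N := by
    refine (Finset.card_erase_le.trans (Multiset.toFinset_card_le _)).trans ?_
    rw [Multiset.card_add]
    lia
  have hdeg : p.totalDegree ≤ 2 * N := by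
    refine (MvPolynomial.totalDegree_finsetProd _ _).trans ((Finset.sum_le_card_nsmul _ _ 1
      fun y hy => (hℓ y (Finset.ne_of_mem_erase hy)).1).trans ?_)
    rwa [smul_eq_mul, mul_one]
  have hzero : ∀ y, y ≠ x₀ → y ∈ s + t → MvPolynomial.eval (f y) p = 0 := fun y hy hm => by
    rw [map_prod]
    exact Finset.prod_eq_zero (Finset.mem_erase.2 ⟨hy, Multiset.mem_toFinset.2 hm⟩) (hℓ y hy).2.1
  have hne : MvPolynomial.eval (f x₀) p ≠ 0 := by
    rw [map_prod]
    exact Finset.prod_ne_zero_iff.2 fun y hy => (hℓ y (Finset.ne_of_mem_erase hy)).2.2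
  have := hp p hdeg
  rw [Multiset.sum_map_eq_nsmul_single x₀ fun y hy hm =>
      hzero y hy (Multiset.mem_add.2 (Or.inl hm)),
    Multiset.sum_map_eq_nsmul_single x₀ fun y hy hm =>
      hzero y hy (Multiset.mem_add.2 (Or.inr hm)), nsmul_eq_mul, nsmul_eq_mul] at this
  exact_mod_cast mul_right_cancel₀ hne this

theorem HasContinuousInjOn.multiset {X : Type} [TopologicalSpace X]
    (h : HasContinuousInjOn (Set.univ : Set X)) (N : ℕ) :
    HasContinuousInjOn {s : Multiset X | (Multiset.card s : ℕ∞) ≤ N} := by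
  obtain ⟨d, f, hf, hfi⟩ := h
  refine .of_fintype (ι := Fin d → Fin (2 * N + 1))
    (fun s α => (s.map fun x => ∏ i, f x i ^ (α i : ℕ)).sum) ?_ ?_
  · exact continuous_pi fun α => continuous_multiset_sum_map (by fun_prop)
  · intro s hs t ht h
    exact multiset_eq_of_sum_monomials (Set.injOn_univ.1 hfi) (by exact_mod_cast hs)
      (by exact_mod_cast ht) (congrFun h)

theorem hasContinuousInjOn_vec_prod_real (d : ℕ) :
    HasContinuousInjOn (Set.univ : Set (Vec d × ℝ)) := by
  rw [← Set.univ_prod_univ]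
  exact (hasContinuousInjOn_vec d _).prod ⟨1, fun x _ => x, by fun_prop,
    fun x _ y _ h => congrFun h 0⟩

theorem Agg.hasContinuousInjOn (d N : ℕ) (a : Agg) :
    HasContinuousInjOn {x : Agg.Val (Vec d) a | (a.size x : ℕ∞) ≤ N} := by
  cases a
  exacts [hasContinuousInjOn_vec d _, hasContinuousInjOn_vec d _, hasContinuousInjOn_vec d _,
    (hasContinuousInjOn_vec d _).multiset N, (hasContinuousInjOn_vec d _).multiset N,
    (hasContinuousInjOn_vec_prod_real d).multiset N,
    (hasContinuousInjOn_vec_prod_real d).multiset N]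

theorem hasContinuousInjOn_layerInput (B : Set Agg) (d N : ℕ) :
    HasContinuousInjOn {x : LayerInput B (Vec d) | ∀ a : B, (a.1.size (x.2 a) : ℕ∞) ≤ N} := by
  have := (hasContinuousInjOn_vec d Set.univ).prod
    (HasContinuousInjOn.pi fun a : B => Agg.hasContinuousInjOn d N a.1)
  rwa [Set.univ_prod] at this

end Continuous

theorem exists_injective_model (B : Set Agg) (L : ℕ) : ∃ M : GeoA B L, M.IsInjectiveUpTo ⊤ := by
  obtain ⟨M, hM, -⟩ := exists_model B L ⊤ (fun _ _ _ => True) (fun _ _ _ => True)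
    (fun d => by
      obtain ⟨k, f, hf⟩ := exists_injective_vec
        (mk_layerInput_le_continuum (B := B) (mk_vec_le_continuum d))
      exact ⟨k, f, trivial, hf.injOn⟩)
    (fun d => by
      obtain ⟨k, f, hf⟩ := exists_injective_vec
        (mk_multiset_le_continuum (mk_vec_le_continuum d))
      exact ⟨k, f, trivial, hf.injOn⟩)
  exact ⟨M, hM⟩

theorem exists_continuous_model (B : Set Agg) (L N : ℕ) :
    ∃ M : GeoA B L, M.IsContinuous ∧ M.IsInjectiveUpTo N := by
  obtain ⟨M, hM, h1, h2, h3⟩ := exists_model B L N (fun _ _ f => Continuous f)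
    (fun _ _ f => Continuous f) (fun d => hasContinuousInjOn_layerInput B d N)
    (fun d => (hasContinuousInjOn_vec d _).multiset N)
  exact ⟨M, ⟨fun l _ => h1 l, h2, h3⟩, hM⟩

theorem theorem4 :
    ∃ C : ℕ, ∀ (B : Set Agg) (pool : Pooling) (L : ℕ), C < L →
      (Agg.localU ∈ B ∨ Agg.localV ∈ B) →
        (∀ (N : ℕ∞) (M : GeoA B L), M.IsInjectiveUpTo N →
          IsE3CompleteUpTo N (M.output ⊤ ⊤ pool)) ∧
        (∃ M : GeoA B L, M.IsInjectiveUpTo ⊤) ∧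
        (∀ N : ℕ, ∃ M : GeoA B L, M.IsContinuous ∧ M.IsInjectiveUpTo N) :=
  -- `4 < L` supplies the five rounds of refinement.
  ⟨4, fun B pool L hL hB => ⟨fun _ _ hM => hM.isE3CompleteUpTo hL hB pool,
    exists_injective_model B L, exists_continuous_model B L⟩⟩
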